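/- Let $k=\mathbb{Q}(\sqrt{-3})$ with ring of integers $\mathfrak{O}_k=\mathbb{Z}[\zeta_3]$, $\zeta_3=e^{2\pi i/3}$, and let $\mathrm{N}(\mathfrak{p})$ denote the norm of a (nonzero) prime ideal $\mathfrak{p}$ of $\mathfrak{O}_k$. For $s\in\mathbb{C}$ with $\Re(s)>\frac12$ and $y=y_1+iy_2\in\mathbb{C}$ define $\widetilde{M}_s(y)=\widetilde{M}_s(y_1,y_2)$, in Case 1 (the case of $\log L$), by \[ \widetilde{M}_{s}(y)= \exp\left(-i\Re\left(\bar{y}\log\left(1-3^{-s}\right)\right)\right)\prod_{\mathfrak{p}\nmid\langle3\rangle} \left( \frac{1}{\mathrm{N}(\mathfrak{p})+1}+\frac{1}{3}\frac{\mathrm{N}(\mathfrak{p})}{\mathrm{N}(\mathfrak{p})+1}\sum_{j=0}^{2}\exp\left(-i\Re\left(\bar{y}\log\left(1-\frac{\zeta_{3}^{j}}{\mathrm{N}(\mathfrak{p})^{s}}\right)\right)\right) \right) \] (with the principal logarithm), and, in Case 2 (the case of $L'/L$), by \[ \widetilde{M}_{s}(y)= \exp\left(-i\Re\left(\frac{\bar{y}\log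 3}{3^{s}-1}\right)\right)\prod_{\mathfrak{p}\nmid\langle3\rangle} \left( \frac{1}{\mathrm{N}(\mathfrak{p})+1}+\frac{1}{3}\frac{\mathrm{N}(\mathfrak{p})}{\mathrm{N}(\mathfrak{p})+1}\sum_{j=0}^{2}\exp\left(-i\Re\left(\frac{\bar{y}\,\zeta_{3}^{j}\log\mathrm{N}(\mathfrak{p})}{\mathrm{N}(\mathfrak{p})^{s}-\zeta_{3}^{j}}\right)\right) \right). \] Then for every $\sigma>\frac12$ there are positive constants $C_1$ and $C_2$, depending only on $\sigma$, such that the following holds for each fixed $s$ with $\Re(s)=\sigma$: both products converge unconditionally for every $y\in\mathbb{C}$, and, for all $y$ with $|y|$ sufficiently large, \[ \left|\widetilde{M}_s(y)\right|\leq\begin{cases}\exp\left(-C_1|y|^{\frac1{\sigma}}\left(\log|y|\right)^{-1}\right)& \text{in Case 1},\\[2pt] \exp\left(-C_2|y|^{\frac1{\sigma}}\left(\log|y|\right)^{\frac{1}{\sigma}-1}\right) &\text{in Case 2}.\end{cases} \] -/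

import Mathlib

open scoped NumberField

noncomputable section

namespace CubicTwists

/-- The field `k = ℚ(√-3) = ℚ(ζ₃)`. -/
abbrev k : Type := CyclotomicField 3 ℚ

/-- The complex number `ζ₃ = exp(2πi/3)`. -/
def zeta3 : ℂ := Complex.exp (2 * Real.pi * Complex.I / 3)

/-- The prime ideals `𝔭` of `𝓞 k` (nonzero, as usual) with `𝔭 ∤ ⟨3⟩`. -/
abbrev PrimeNotDvdThree : Type :=
  {p : IsDedekindDomain.HeightOneSpectrum (𝓞 k) //
    ¬ p.asIdeal ∣ Ideal.span {(3 : 𝓞 k)}}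

/-- `a_{𝔭,j}(s) = log(1 - ζ₃^j N(𝔭)^{-s})` for `N(𝔭) = N` (the case of `log L`), with the
principal logarithm. -/
def aLog (s : ℂ) (N j : ℕ) : ℂ :=
  Complex.log (1 - zeta3 ^ j * (N : ℂ) ^ (-s))

/-- `a_{𝔭,j}(s) = ζ₃^j log N(𝔭) / (N(𝔭)^s - ζ₃^j)` for `N(𝔭) = N` (the case of `L'/L`). -/
def aLogDeriv (s : ℂ) (N j : ℕ) : ℂ :=
  zeta3 ^ j * (Real.log N : ℂ) / ((N : ℂ) ^ s - zeta3 ^ j)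

/-- `exp(-i Re(ȳ a))`. -/
def phase (y a : ℂ) : ℂ :=
  Complex.exp (-Complex.I * (((starRingEnd ℂ) y * a).re : ℂ))

/-- The Euler factor `1/(N+1) + (1/3) (N/(N+1)) ∑_{j=0}^{2} exp(-i Re(ȳ a_{𝔭,j}))`, `N = N(𝔭)`. -/
def eulerFactor (a : ℕ → ℕ → ℂ) (y : ℂ) (p : PrimeNotDvdThree) : ℂ :=
  1 / ((Ideal.absNorm p.1.asIdeal : ℂ) + 1) +
    1 / 3 * ((Ideal.absNorm p.1.asIdeal : ℂ) / ((Ideal.absNorm p.1.asIdeal : ℂ) + 1)) *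
      ∑ j ∈ Finset.range 3, phase y (a (Ideal.absNorm p.1.asIdeal) j)

/-- The factor `exp(-i Re(ȳ a_{𝔭,0}))` at the prime above `3` (which has norm `3`) times the
product of the Euler factors over all prime ideals `𝔭 ∤ ⟨3⟩`. -/
def charProduct (a : ℕ → ℕ → ℂ) (y : ℂ) : ℂ :=
  phase y (a 3 0) * ∏' p : PrimeNotDvdThree, eulerFactor a y p

/-- `M̃_s(y)` in the case of `log L`. -/
def MtildeLog (s y : ℂ) : ℂ := charProduct (aLog s) y

/-- `M̃_s(y)` in the case of `L'/L`. -/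
def MtildeLogDeriv (s y : ℂ) : ℂ := charProduct (aLogDeriv s) y

end CubicTwists

end

open scoped NumberField

/-! Every Euler factor is a convex combination of `1` and three unit phases, so it has norm at most
`1`, and any set of factors may be discarded when bounding the product from above. The coefficients
satisfy `a_{N,j} ≈ ζ₃^j c_N`, with `c_N = -N^{-s}` or `c_N = log N · N^{-s}`. If `|y||c_N| ≤ 1/2`,
the three phases spread by an amount comparable to `|y||c_N|` whatever the argument of `y`, and the
factor is at most `exp(-(|y||c_N|)²/100)` (`norm_eulerFactor_le_exp`).

Choose `X` so that `|y||c_N|` lies between two positive constants for all `N ∈ [X, BX]`: `X ≍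
|y|^{1/σ}` in Case 1 and `X ≍ (|y| log|y|)^{1/σ}` in Case 2. Each prime `p ≡ 1 (mod 3)` in that
range splits, hence is the norm of a prime ideal, and there are at least `X / log(BX)` of them. So
the product is at most `exp(-c X / log X)`, which is the claim. Neither `B` nor `c` depends on `y`
or `Im s`.

The count needs no prime number theorem: a Mertens estimate for `p ≡ 1 (mod 3)`, resting on `L(1, χ)
> 0`, puts enough primes in `(X, BX]` once `B` is large. Convergence comes from `1 + ζ₃ + ζ₃² = 0`,
which cancels the linear term of each factor and leaves `O(N^{-2τ})` with `2τ > 1`. -/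

namespace CubicTwists

/-! ### Mertens and Chebyshev estimates for primes `≡ 1 (mod 3)` -/

section PrimesModThree

open ArithmeticFunction Finset

/-- The nontrivial Dirichlet character modulo `3`, with real values. -/
noncomputable def chi3 (n : ℕ) : ℝ := if n % 3 = 1 then 1 else if n % 3 = 2 then -1 else 0

lemma chi3_mul (m n : ℕ) : chi3 (m * n) = chi3 m * chi3 n := by
  have hm : m % 3 < 3 := Nat.mod_lt _ (by norm_num)
  have hn : n % 3 < 3 := Nat.mod_lt _ (by norm_num)
  unfold chi3
  rw [Nat.mul_mod]
  interval_cases m % 3 <;> interval_cases n % 3 <;> norm_num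

lemma abs_chi3_le_one (n : ℕ) : |chi3 n| ≤ 1 := by
  unfold chi3
  split_ifs <;> norm_num

/-- The partial sums `∑_{m ≤ n} χ(m)` of the character modulo `3`. -/
noncomputable def chi3Sum (n : ℕ) : ℝ := if n % 3 = 1 then 1 else 0

lemma chi3_succ (n : ℕ) : chi3 (n + 1) = chi3Sum (n + 1) - chi3Sum n := by
  have hn : n % 3 < 3 := Nat.mod_lt _ (by norm_num)
  unfold chi3 chi3Sum
  rw [Nat.add_mod]
  interval_cases n % 3 <;> norm_num

lemma chi3Sum_nonneg (n : ℕ) : 0 ≤ chi3Sum n := by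
  unfold chi3Sum
  split_ifs <;> norm_num

lemma chi3Sum_le_one (n : ℕ) : chi3Sum n ≤ 1 := by
  unfold chi3Sum
  split_ifs <;> norm_num

/-- Sums of the character modulo `3` against a decreasing nonnegative weight. -/
lemma abs_sum_Ioc_chi3_mul_le {f : ℕ → ℝ} {a b : ℕ} (hab : a ≤ b) (hf : ∀ n, 0 ≤ f n)
    (hanti : ∀ n, a ≤ n → f (n + 1) ≤ f n) :
    |∑ n ∈ Ioc a b, chi3 n * f n| ≤ f a := by
  -- Summation by parts; keeping the boundary term `chi3Sum b * f b` makes the bound inductive.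
  have key : -f a + chi3Sum b * f b ≤ ∑ n ∈ Ioc a b, chi3 n * f n ∧
      ∑ n ∈ Ioc a b, chi3 n * f n ≤ f a - f b + chi3Sum b * f b := by
    induction b, hab using Nat.le_induction with
    | base =>
      simp only [Ioc_self, sum_empty]
      constructor <;> nlinarith [hf a, chi3Sum_nonneg a, chi3Sum_le_one a]
    | succ b hab ih =>
      rw [← Finset.sum_Ioc_consecutive _ hab (Nat.le_succ b)]
      simp only [Nat.Ioc_succ_singleton, sum_singleton]
      rw [chi3_succ]
      have h1 := hanti b hab
      have h2 := chi3Sum_nonneg b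
      have h3 := chi3Sum_le_one b
      constructor <;> nlinarith [ih.1, ih.2]
  have h2 := chi3Sum_nonneg b
  have h3 := chi3Sum_le_one b
  have h4 := hf b
  rw [abs_le]
  constructor <;> nlinarith [key.1, key.2]

/-- The partial sums of `L(1, χ)` for the character modulo `3`. -/
noncomputable def chi3LSum (M : ℕ) : ℝ := ∑ m ∈ Ioc 0 M, chi3 m * (m : ℝ)⁻¹

lemma abs_chi3LSum_sub_le {a b : ℕ} (ha : 0 < a) (hab : a ≤ b) :
    |chi3LSum b - chi3LSum a| ≤ (a : ℝ)⁻¹ := by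
  unfold chi3LSum
  rw [← Finset.sum_Ioc_consecutive _ (Nat.zero_le a) hab, add_sub_cancel_left]
  refine abs_sum_Ioc_chi3_mul_le (f := fun n : ℕ => (n : ℝ)⁻¹) hab (fun n => by positivity)
    fun n hn => ?_
  have : (0 : ℝ) < n := by exact_mod_cast ha.trans_le hn
  push_cast
  gcongr
  linarith

/-- `L(1, χ)` exists and is positive, with an error term for its partial sums. -/
lemma exists_chi3LSum_limit :
    ∃ L : ℝ, 1 / 2 ≤ L ∧ ∀ a : ℕ, 0 < a → |L - chi3LSum a| ≤ (a : ℝ)⁻¹ := by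
  have hC : CauchySeq chi3LSum := by
    refine Metric.cauchySeq_iff'.2 fun ε hε => ?_
    obtain ⟨n, hn⟩ := exists_nat_one_div_lt hε
    refine ⟨n + 1, fun m hm => ?_⟩
    rw [Real.dist_eq]
    refine (abs_chi3LSum_sub_le (Nat.succ_pos n) hm).trans_lt ?_
    simpa using hn
  obtain ⟨L, hL⟩ := cauchySeq_tendsto_of_complete hC
  have hbd : ∀ a : ℕ, 0 < a → |L - chi3LSum a| ≤ (a : ℝ)⁻¹ := fun a ha =>
    le_of_tendsto (hL.sub_const _).abs
      (Filter.eventually_atTop.2 ⟨a, fun b hb => abs_chi3LSum_sub_le ha hb⟩)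
  refine ⟨L, ?_, hbd⟩
  -- The partial sum `1 - 1/2 + 1/4 = 3/4` has error at most `1/4`, so `L ≥ 1/2`.
  have h4 := hbd 4 (by norm_num)
  have : chi3LSum 4 = 3 / 4 := by
    simp only [chi3LSum, show Ioc 0 4 = {1, 2, 3, 4} from rfl]
    norm_num [chi3]
  rw [this, abs_le] at h4
  norm_num at h4
  linarith [h4.1]

lemma psi_natCast (N : ℕ) : Chebyshev.psi N = ∑ n ∈ Ioc 0 N, vonMangoldt n := by
  simp [Chebyshev.psi]

/-- Chebyshev's identity: sum `Λ * ζ = log` up to `N`. Replacing `⌊N/n⌋` by `N/n` then costs at most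
`ψ(N) = O(N)`. -/
lemma sum_log_eq_sum_vonMangoldt_mul_div (N : ℕ) :
    Real.log N.factorial = ∑ n ∈ Ioc 0 N, vonMangoldt n * ((N / n : ℕ) : ℝ) := by
  rw [← sum_Ioc_mul_zeta_eq_sum, vonMangoldt_mul_zeta]
  simp only [log_apply]
  induction N with
  | zero => simp
  | succ N ih =>
    rw [Nat.factorial_succ, Nat.cast_mul, Real.log_mul (by positivity) (by positivity), ih,
      ← Finset.sum_Ioc_consecutive _ (Nat.zero_le N) (Nat.le_succ N)]
    simp [add_comm]

/-- The Mertens estimate for `∑ Λ(n) / n`. -/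
lemma exists_abs_sum_vonMangoldt_div_sub_log_le :
    ∃ C : ℝ, ∀ N : ℕ, 0 < N →
      |∑ n ∈ Ioc 0 N, vonMangoldt n / n - Real.log N| ≤ C := by
  refine ⟨Real.log 4 + 4, fun N hN => ?_⟩
  have hN' : (0 : ℝ) < N := by exact_mod_cast hN
  have h4 : 0 ≤ Real.log 4 := Real.log_nonneg (by norm_num)
  have hψ : Chebyshev.psi N ≤ (Real.log 4 + 4) * N := Chebyshev.psi_le_const_mul_self hN'.le
  rw [psi_natCast] at hψ
  have hfac := sum_log_eq_sum_vonMangoldt_mul_div N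
  have hlow : N * Real.log N - N ≤ Real.log N.factorial := by
    have := Stirling.le_log_factorial_stirling hN.ne'
    have h1 : 0 ≤ Real.log N := Real.log_natCast_nonneg N
    have h2 : 0 ≤ Real.log (2 * Real.pi) :=
      Real.log_nonneg (by linarith [Real.pi_gt_three])
    linarith
  have hup : Real.log N.factorial ≤ N * Real.log N := by
    rw [← Real.log_pow]
    exact Real.log_le_log (by positivity) (by exact_mod_cast Nat.factorial_le_pow N)
  have hle : Real.log N.factorial ≤ N * ∑ n ∈ Ioc 0 N, vonMangoldt n / n := by
    rw [hfac, mul_sum]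
    refine sum_le_sum fun n _ => ?_
    calc vonMangoldt n * ((N / n : ℕ) : ℝ) ≤ vonMangoldt n * ((N : ℝ) / n) :=
          mul_le_mul_of_nonneg_left Nat.cast_div_le vonMangoldt_nonneg
      _ = _ := by ring
  have hge : N * ∑ n ∈ Ioc 0 N, vonMangoldt n / n - ∑ n ∈ Ioc 0 N, vonMangoldt n ≤
      Real.log N.factorial := by
    rw [hfac, mul_sum, ← sum_sub_distrib]
    refine sum_le_sum fun n hn => ?_
    have hn0 : 0 < n := (mem_Ioc.1 hn).1
    have : (N : ℝ) / n ≤ ((N / n : ℕ) : ℝ) + 1 := by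
      rw [div_le_iff₀ (by exact_mod_cast hn0)]
      have h := (Nat.lt_mul_div_succ N hn0).le
      rw [mul_comm] at h
      exact_mod_cast h
    have h1 := mul_le_mul_of_nonneg_left this (vonMangoldt_nonneg (n := n))
    calc (N : ℝ) * (vonMangoldt n / n) - vonMangoldt n
        = vonMangoldt n * ((N : ℝ) / n) - vonMangoldt n := by ring
      _ ≤ _ := by linarith
  rw [abs_le]
  constructor <;> refine le_of_mul_le_mul_left ?_ hN' <;> nlinarith

lemma exists_abs_sum_chi3_mul_log_div_le :
    ∃ C : ℝ, ∀ N : ℕ, |∑ n ∈ Ioc 0 N, chi3 n * (Real.log n / n)| ≤ C := by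
  have hnn : ∀ n : ℕ, 0 ≤ Real.log n / n := fun n =>
    div_nonneg (Real.log_natCast_nonneg n) n.cast_nonneg
  -- `log x / x` decreases only from `e` on, so the terms up to `3` are bounded separately.
  refine ⟨∑ n ∈ Ioc (0 : ℕ) 3, Real.log n / n + Real.log (3 : ℕ) / (3 : ℕ), fun N => ?_⟩
  have hsmall : ∀ M, M ≤ 3 → |∑ n ∈ Ioc 0 M, chi3 n * (Real.log n / n)| ≤
      ∑ n ∈ Ioc (0 : ℕ) 3, Real.log n / n := fun M hM => by
    refine (abs_sum_le_sum_abs _ _).trans ?_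
    refine (sum_le_sum (g := fun n : ℕ => Real.log n / n) fun n _ => ?_).trans
      (sum_le_sum_of_subset_of_nonneg (Ioc_subset_Ioc_right hM) fun n _ _ => hnn n)
    rw [abs_mul, abs_of_nonneg (hnn n)]
    exact mul_le_of_le_one_left (hnn n) (abs_chi3_le_one n)
  rcases le_total N 3 with h | h
  · exact (hsmall N h).trans (le_add_of_nonneg_right (hnn 3))
  · rw [← Finset.sum_Ioc_consecutive _ (Nat.zero_le 3) h]
    refine (abs_add_le _ _).trans (add_le_add (hsmall 3 le_rfl) ?_)
    refine abs_sum_Ioc_chi3_mul_le (f := fun n : ℕ => Real.log n / n) h hnn fun n hn => ?_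
    have h3 : Real.exp 1 ≤ n :=
      Real.exp_one_lt_three.le.trans (by exact_mod_cast hn)
    exact Real.log_div_self_antitoneOn (Set.mem_Ici.2 h3)
      (Set.mem_Ici.2 (h3.trans (by push_cast; linarith))) (by push_cast; linarith)

/-- Since `χ` is completely multiplicative, `χ(n) log n / n` is the Dirichlet convolution of
`χ(n)Λ(n)/n` and `χ(n)/n`. With the inner sum close to `L(1, χ)`, this bounds `L(1, χ) ∑
χ(n)Λ(n)/n`. -/
lemma sum_chi3_mul_log_div_eq (N : ℕ) :
    ∑ n ∈ Ioc 0 N, chi3 n * (Real.log n / n) =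
      ∑ n ∈ Ioc 0 N, chi3 n * (vonMangoldt n / n) * chi3LSum (N / n) := by
  let f : ArithmeticFunction ℝ := ⟨fun n => chi3 n * (vonMangoldt n / n), by simp⟩
  let g : ArithmeticFunction ℝ := ⟨fun n => chi3 n * (n : ℝ)⁻¹, by simp⟩
  have h := sum_Ioc_mul_eq_sum_sum f g N
  refine Eq.trans (sum_congr rfl fun n _ => ?_) h
  rw [mul_apply, ← vonMangoldt_sum, ← Nat.map_div_right_divisors, sum_div, mul_sum, sum_map]
  refine sum_congr rfl fun d hd => ?_
  have hdn := Nat.dvd_of_mem_divisors hd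
  have hc : chi3 n = chi3 d * chi3 (n / d) := by
    rw [← chi3_mul, Nat.mul_div_cancel' hdn]
  have hn : (n : ℝ) = d * (n / d : ℕ) := by
    exact_mod_cast (Nat.mul_div_cancel' hdn).symm
  change _ = chi3 d * (vonMangoldt d / d) * (chi3 (n / d) * ((n / d : ℕ) : ℝ)⁻¹)
  rw [hc, hn, div_eq_mul_inv, mul_inv]
  ring

/-- The Mertens estimate twisted by the character modulo `3`. -/
lemma exists_abs_sum_chi3_mul_vonMangoldt_div_le :
    ∃ C : ℝ, ∀ N : ℕ, 0 < N → |∑ n ∈ Ioc 0 N, chi3 n * (vonMangoldt n / n)| ≤ C := by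
  obtain ⟨L, hL, hLb⟩ := exists_chi3LSum_limit
  obtain ⟨C, hC⟩ := exists_abs_sum_chi3_mul_log_div_le
  refine ⟨2 * (C + 2 * (Real.log 4 + 4)), fun N hN => ?_⟩
  have hN' : (0 : ℝ) < N := by exact_mod_cast hN
  have hψ : Chebyshev.psi N ≤ (Real.log 4 + 4) * N := Chebyshev.psi_le_const_mul_self hN'.le
  rw [psi_natCast] at hψ
  set T := ∑ n ∈ Ioc 0 N, chi3 n * (vonMangoldt n / n) with hT
  have hdiff : |L * T - ∑ n ∈ Ioc 0 N, chi3 n * (Real.log n / n)| ≤ 2 * (Real.log 4 + 4) := by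
    rw [sum_chi3_mul_log_div_eq, hT, mul_sum, ← sum_sub_distrib]
    refine (abs_sum_le_sum_abs _ _).trans ?_
    calc ∑ n ∈ Ioc 0 N, |L * (chi3 n * (vonMangoldt n / n)) -
            chi3 n * (vonMangoldt n / n) * chi3LSum (N / n)|
        ≤ ∑ n ∈ Ioc 0 N, 2 / N * vonMangoldt n := sum_le_sum fun n hn => ?_
      _ = 2 / N * ∑ n ∈ Ioc 0 N, vonMangoldt n := by rw [mul_sum]
      _ ≤ 2 / N * ((Real.log 4 + 4) * N) := by gcongr
      _ = _ := by field_simp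
    obtain ⟨hn0, hnN⟩ := mem_Ioc.1 hn
    have hn' : (0 : ℝ) < n := by exact_mod_cast hn0
    have hM : 0 < N / n := Nat.div_pos hnN hn0
    have hM' : (1 : ℝ) ≤ (N / n : ℕ) := by exact_mod_cast hM
    have hΛ : 0 ≤ vonMangoldt n / n := div_nonneg vonMangoldt_nonneg hn'.le
    have hlt : (N : ℝ) ≤ n * ((N / n : ℕ) + 1) := by
      exact_mod_cast (Nat.lt_mul_div_succ N hn0).le
    -- As `⌊N/n⌋ ≥ 1`, one has `N ≤ n(⌊N/n⌋ + 1) ≤ 2n⌊N/n⌋`.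
    have hinv : ((N / n : ℕ) : ℝ)⁻¹ ≤ 2 * n / N := by
      rw [inv_le_iff_one_le_mul₀ (by linarith), div_mul_eq_mul_div, le_div_iff₀ hN']
      nlinarith
    calc |L * (chi3 n * (vonMangoldt n / n)) - chi3 n * (vonMangoldt n / n) * chi3LSum (N / n)|
        = |chi3 n| * (vonMangoldt n / n) * |L - chi3LSum (N / n)| := by
          rw [← abs_of_nonneg hΛ, ← abs_mul, ← abs_mul, abs_of_nonneg hΛ]
          congr 1
          ring
      _ ≤ 1 * (vonMangoldt n / n) * (2 * n / N) := by
          gcongr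
          · exact abs_chi3_le_one n
          · exact (hLb _ hM).trans hinv
      _ = _ := by field_simp
  have h1 : |L * T| ≤ C + 2 * (Real.log 4 + 4) := by
    have := abs_le.1 (hC N)
    have := abs_le.1 hdiff
    rw [abs_le]
    constructor <;> linarith
  rw [abs_mul, abs_of_nonneg (by linarith : 0 ≤ L)] at h1
  nlinarith [abs_nonneg T]

lemma exists_sum_nonprime_residueClass_div_le (a : ZMod 3) :
    ∃ C : ℝ, ∀ N : ℕ,
      ∑ n ∈ Ioc 0 N, (if n.Prime then 0 else vonMangoldt.residueClass a n) / n ≤ C :=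
  ⟨_, fun N => (vonMangoldt.summable_residueClass_non_primes_div a).sum_le_tsum _ fun n _ => by
    have := vonMangoldt.residueClass_nonneg a n
    split_ifs <;> positivity⟩

/-- `1 + χ` equals `2, 0, 1` on the classes `1, 2, 0`. Apart from the primes `≡ 1`, only prime
powers and the single prime `3` remain, and these contribute `O(1)` to the Mertens sum. -/
lemma one_add_chi3_mul_vonMangoldt (n : ℕ) :
    (1 + chi3 n) * vonMangoldt n =
      2 * (if n.Prime ∧ n % 3 = 1 then Real.log n else 0) +
      2 * (if n.Prime then 0 else vonMangoldt.residueClass (1 : ZMod 3) n) +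
      (if n.Prime then 0 else vonMangoldt.residueClass (0 : ZMod 3) n) +
      (if n = 3 then Real.log 3 else 0) := by
  have h1 : ((n : ZMod 3) = 1) ↔ n % 3 = 1 := by
    rw [show (1 : ZMod 3) = ((1 : ℕ) : ZMod 3) by simp, ZMod.natCast_eq_natCast_iff']
  have h0 : ((n : ZMod 3) = 0) ↔ n % 3 = 0 := by
    rw [show (0 : ZMod 3) = ((0 : ℕ) : ZMod 3) by simp, ZMod.natCast_eq_natCast_iff']
  have hlt : n % 3 < 3 := Nat.mod_lt _ (by norm_num)
  simp only [vonMangoldt.residueClass, Set.indicator_apply, Set.mem_ofPred_eq, h1, h0, chi3]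
  by_cases hp : n.Prime
  · rw [vonMangoldt_apply_prime hp]
    have h3 : n % 3 = 0 → n = 3 := fun h =>
      ((Nat.prime_dvd_prime_iff_eq Nat.prime_three hp).1 (Nat.dvd_of_mod_eq_zero h)).symm
    have h3' : n = 3 → n % 3 = 0 := fun h => by rw [h]
    by_cases h : n = 3
    · subst h
      norm_num [hp]
    · have hne : n % 3 ≠ 0 := fun h' => h (h3 h')
      simp only [hp, h]
      generalize n % 3 = r at *
      interval_cases r <;> norm_num at *
  · have h : n ≠ 3 := fun h => hp (h ▸ Nat.prime_three)
    simp only [hp, h]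
    generalize n % 3 = r at *
    interval_cases r <;> norm_num

/-- The Mertens estimate for the primes congruent to `1` modulo `3`. -/
lemma exists_abs_sum_primes_one_mod_three_sub_log_le :
    ∃ C : ℝ, ∀ N : ℕ, 0 < N →
      |2 * ∑ p ∈ Ioc 0 N with p.Prime ∧ p % 3 = 1, Real.log p / p - Real.log N| ≤ C := by
  obtain ⟨C₁, h₁⟩ := exists_abs_sum_vonMangoldt_div_sub_log_le
  obtain ⟨C₂, h₂⟩ := exists_abs_sum_chi3_mul_vonMangoldt_div_le
  obtain ⟨C₃, h₃⟩ := exists_sum_nonprime_residueClass_div_le 1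
  obtain ⟨C₄, h₄⟩ := exists_sum_nonprime_residueClass_div_le 0
  refine ⟨C₁ + C₂ + 2 * C₃ + C₄ + Real.log 3, fun N hN => ?_⟩
  have hnn : ∀ a : ZMod 3, 0 ≤
      ∑ n ∈ Ioc 0 N, (if n.Prime then 0 else vonMangoldt.residueClass a n) / (n : ℝ) :=
    fun a => sum_nonneg fun n _ => by
      have := vonMangoldt.residueClass_nonneg a n
      split_ifs <;> positivity
  have hl3 : 0 ≤ Real.log 3 := Real.log_nonneg (by norm_num)
  have h5 : 0 ≤ ∑ n ∈ Ioc 0 N, (if n = 3 then Real.log 3 else 0) / (n : ℝ) :=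
    sum_nonneg fun n _ => by split_ifs <;> positivity
  have h5' : ∑ n ∈ Ioc 0 N, (if n = 3 then Real.log 3 else 0) / (n : ℝ) ≤ Real.log 3 := by
    simp only [ite_div, zero_div]
    rw [sum_ite_eq']
    split_ifs
    · exact div_le_self hl3 (by norm_num)
    · exact hl3
  have hsum : ∑ n ∈ Ioc 0 N, vonMangoldt n / n + ∑ n ∈ Ioc 0 N, chi3 n * (vonMangoldt n / n) =
      2 * ∑ p ∈ Ioc 0 N with p.Prime ∧ p % 3 = 1, Real.log p / p +
      2 * ∑ n ∈ Ioc 0 N, (if n.Prime then 0 else vonMangoldt.residueClass (1 : ZMod 3) n) / (n : ℝ) +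
      ∑ n ∈ Ioc 0 N, (if n.Prime then 0 else vonMangoldt.residueClass (0 : ZMod 3) n) / (n : ℝ) +
      ∑ n ∈ Ioc 0 N, (if n = 3 then Real.log 3 else 0) / (n : ℝ) := by
    rw [sum_filter, mul_sum, mul_sum, ← sum_add_distrib, ← sum_add_distrib, ← sum_add_distrib,
      ← sum_add_distrib]
    refine sum_congr rfl fun n _ => ?_
    have h := congrArg (· / (n : ℝ)) (one_add_chi3_mul_vonMangoldt n)
    rw [show (if n.Prime ∧ n % 3 = 1 then Real.log n / n else 0) =
      (if n.Prime ∧ n % 3 = 1 then Real.log n else 0) / n by split_ifs <;> simp]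
    linear_combination h
  have a1 := abs_le.1 (h₁ N hN)
  have a2 := abs_le.1 (h₂ N hN)
  have a3 := h₃ N
  have a4 := h₄ N
  have a5 := hnn 1
  have a6 := hnn 0
  rw [abs_le]
  constructor <;> linarith [a1.1, a1.2, a2.1, a2.2]

/-- A Chebyshev-type lower bound for the primes congruent to `1` modulo `3` in `(X, BX]`. -/
lemma exists_card_primes_one_mod_three_ge :
    ∃ B : ℝ, 1 < B ∧ ∀ X : ℝ, 1 ≤ X →
      X ≤ Real.log (B * X) *
        #{p ∈ Ioc ⌊X⌋₊ ⌊B * X⌋₊ | p.Prime ∧ p % 3 = 1} := by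
  obtain ⟨C, hC⟩ := exists_abs_sum_primes_one_mod_three_sub_log_le
  have hC0 : 0 ≤ C := (abs_nonneg _).trans (hC 1 one_pos)
  -- The exponential beats both Mertens errors `C` and leaves a weighted sum of at least `1` over
  -- `(X, BX]`; the factor `2` absorbs the floor of `BX`.
  set B : ℝ := 2 * Real.exp (2 * C + 2) with hB
  have hB2 : 2 < B := by
    have : 1 < Real.exp (2 * C + 2) := Real.one_lt_exp_iff.2 (by linarith)
    linarith
  refine ⟨B, by linarith, fun X hX => ?_⟩
  have hX0 : 0 < X := by linarith
  have hBX : 2 ≤ B * X := by nlinarith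
  have hXB : X ≤ B * X := by nlinarith
  have hN₁ : 0 < ⌊X⌋₊ := Nat.floor_pos.2 hX
  have hN₂ : 0 < ⌊B * X⌋₊ := Nat.floor_pos.2 (by linarith)
  have hle : ⌊X⌋₊ ≤ ⌊B * X⌋₊ := Nat.floor_mono hXB
  have h1 := (abs_le.1 (hC _ hN₁)).2
  have h2 := (abs_le.1 (hC _ hN₂)).1
  have hlog1 : Real.log ⌊X⌋₊ ≤ Real.log X :=
    Real.log_le_log (by exact_mod_cast hN₁) (Nat.floor_le hX0.le)
  have hlog2 : 2 * C + 2 + Real.log X ≤ Real.log ⌊B * X⌋₊ := by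
    rw [← Real.log_exp (2 * C + 2), ← Real.log_mul (Real.exp_pos _).ne' hX0.ne']
    refine Real.log_le_log (by positivity) ?_
    have := Nat.lt_floor_add_one (B * X)
    have : B * X = 2 * (Real.exp (2 * C + 2) * X) := by rw [hB]; ring
    linarith
  have hsplit : ∑ p ∈ Ioc 0 ⌊B * X⌋₊ with p.Prime ∧ p % 3 = 1, Real.log p / p =
      ∑ p ∈ Ioc 0 ⌊X⌋₊ with p.Prime ∧ p % 3 = 1, Real.log p / p +
      ∑ p ∈ Ioc ⌊X⌋₊ ⌊B * X⌋₊ with p.Prime ∧ p % 3 = 1, Real.log p / p := by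
    simp only [sum_filter]
    rw [Finset.sum_Ioc_consecutive _ (Nat.zero_le _) hle]
  have hone : 1 ≤ ∑ p ∈ Ioc ⌊X⌋₊ ⌊B * X⌋₊ with p.Prime ∧ p % 3 = 1, Real.log p / p := by
    linarith
  have hbound := sum_le_card_nsmul
    {p ∈ Ioc ⌊X⌋₊ ⌊B * X⌋₊ | p.Prime ∧ p % 3 = 1} (fun p : ℕ => Real.log p / p)
    (Real.log (B * X) / X) fun p hp => by
      obtain ⟨hp1, hp2⟩ := mem_Ioc.1 (mem_filter.1 hp).1
      have hXp : X ≤ p := ((Nat.floor_lt hX0.le).1 hp1).le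
      have hpB : (p : ℝ) ≤ B * X := (Nat.le_floor_iff (by linarith)).1 hp2
      have : 0 ≤ Real.log (B * X) := Real.log_nonneg (by linarith)
      exact div_le_div₀ this (Real.log_le_log (by linarith) hpB) hX0 hXp
  rw [nsmul_eq_mul] at hbound
  have := hone.trans hbound
  rw [mul_div_assoc', le_div_iff₀ hX0] at this
  linarith

end PrimesModThree

/-! ### Prime ideals of `ℤ[ζ₃]` and summability over their norms -/

/-- A rational prime `p ≡ 1 (mod 3)` is the norm of a prime ideal of `ℤ[ζ₃]` not dividing `3`. -/
lemma exists_primeNotDvdThree_absNorm_eq {p : ℕ} (hp : p.Prime) (hp1 : p % 3 = 1) :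
    ∃ P : PrimeNotDvdThree, Ideal.absNorm P.1.asIdeal = p := by
  have : Fact p.Prime := ⟨hp⟩
  have : (Ideal.span {(p : ℤ)}).IsMaximal :=
    Int.ideal_span_isMaximal_of_prime p
  obtain ⟨⟨P, hP, hPover⟩⟩ := (Ideal.span {(p : ℤ)}).nonempty_primesOver (S := 𝓞 k)
  have hp3 : ¬ p ∣ 3 := fun h => by
    rw [(Nat.prime_dvd_prime_iff_eq hp Nat.prime_three).1 h] at hp1
    norm_num at hp1
  have hcast : (p : ZMod 3) = 1 := by
    rw [show (1 : ZMod 3) = ((1 : ℕ) : ZMod 3) by simp, ZMod.natCast_eq_natCast_iff']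
    simpa using hp1
  have : IsCyclotomicExtension {3} ℚ k := CyclotomicField.isCyclotomicExtension 3 ℚ
  -- The inertia degree is the order of `p` modulo `3`, here `1`.
  have hdeg : P.inertiaDeg ℤ = 1 := by
    rw [IsCyclotomicExtension.Rat.inertiaDeg_eq_of_not_dvd p k P (m := 3) hp3, hcast, orderOf_one]
  have hnorm : Ideal.absNorm P = p := by
    rw [← Ideal.absNorm_pow_inertiaDeg (Ideal.span {(p : ℤ)}) P, hdeg, pow_one]
    simp
  have hbot : P ≠ ⊥ := fun h => by
    rw [h, Ideal.absNorm_bot] at hnorm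
    exact hp.ne_zero hnorm.symm
  refine ⟨⟨⟨P, hP, hbot⟩, fun h3 => hP.ne_top ?_⟩, hnorm⟩
  rw [Ideal.dvd_span_singleton] at h3
  have hpP : ((p : ℕ) : 𝓞 k) ∈ P := by
    have := Ideal.absNorm_mem P
    rwa [hnorm] at this
  rw [Ideal.eq_top_iff_one]
  have hdecomp : (1 : 𝓞 k) = p - 3 * ((p / 3 : ℕ) : 𝓞 k) := by
    have h : p = 3 * (p / 3) + 1 := by omega
    have h' : (p : 𝓞 k) = 3 * ((p / 3 : ℕ) : 𝓞 k) + 1 := by exact_mod_cast congrArg (Nat.cast) h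
    rw [h']
    ring
  rw [hdecomp]
  exact P.sub_mem hpP (P.mul_mem_right _ h3)

/-- The number of ideals of norm at most `n` is `O(n)`, so the Dirichlet series with these
coefficients converges absolutely for `t > 1`. -/
lemma summable_card_absNorm_mul_rpow {K : Type*} [Field K] [NumberField K] {t : ℝ} (ht : 1 < t) :
    Summable fun n : ℕ =>
      (Nat.card {I : Ideal (𝓞 K) // Ideal.absNorm I = n} : ℝ) * (n : ℝ) ^ (-t) := by
  have hO : (fun n : ℕ => ∑ j ∈ Finset.Icc 1 n,
      (Nat.card {I : Ideal (𝓞 K) // Ideal.absNorm I = j} : ℝ)) =O[Filter.atTop]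
        fun n : ℕ => (n : ℝ) ^ (1 : ℝ) := by
    have h := ((NumberField.Ideal.tendsto_norm_le_div_atTop₀ K).comp
      tendsto_natCast_atTop_atTop).isBigO_one ℝ
    have h2 := h.mul (Asymptotics.isBigO_refl (fun n : ℕ => (n : ℝ)) Filter.atTop)
    refine h2.congr' ?_ ?_
    · filter_upwards [Filter.eventually_gt_atTop 0] with n hn
      have hn' : (n : ℝ) ≠ 0 := by exact_mod_cast hn.ne'
      simp only [Function.comp_apply, Nat.cast_le, ← Nat.cast_sum]
      rw [div_mul_cancel₀ _ hn']
      congr 1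
      -- The added `1` is the zero ideal, of norm `0`, which the sum from `1` to `n` omits.
      rw [← add_left_inj 1, ← Ideal.card_norm_le_eq_card_norm_le_add_one,
        show Finset.Icc 1 n = Finset.Ioc 0 n from Finset.Icc_succ_left_eq_Ioc _ _,
        show 1 = Nat.card {I : Ideal (𝓞 K) // Ideal.absNorm I = 0} by
          simp [Ideal.absNorm_eq_zero_iff],
        Finset.sum_Ioc_add_eq_sum_Icc (n.zero_le),
        ← Finset.card_preimage_eq_sum_card_image_eq
          (fun j _ => Ideal.finite_setOfPred_absNorm_eq j)]
      simp [Set.coe_eq_subtype]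
    · filter_upwards with n
      simp
  have hL := LSeriesSummable_of_sum_norm_bigO_and_nonneg hO (fun _ => Nat.cast_nonneg _)
    zero_le_one (s := (t : ℂ)) (by simpa using ht)
  rw [LSeriesSummable, ← summable_norm_iff] at hL
  refine hL.congr fun n => ?_
  rcases Nat.eq_zero_or_pos n with rfl | hn
  · simp [Real.zero_rpow (by linarith : -t ≠ 0)]
  · rw [LSeries.norm_term_eq, if_neg hn.ne', Real.rpow_neg n.cast_nonneg]
    simp [div_eq_mul_inv]

/-- `∑ N(I)^{-t}` over the ideals of a ring of integers converges for `t > 1`. -/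
lemma summable_absNorm_rpow {K : Type*} [Field K] [NumberField K] {t : ℝ} (ht : 1 < t) :
    Summable fun I : Ideal (𝓞 K) => (Ideal.absNorm I : ℝ) ^ (-t) := by
  rw [← (Equiv.sigmaFiberEquiv (Ideal.absNorm (S := 𝓞 K))).summable_iff]
  have : ∀ n, Finite {I : Ideal (𝓞 K) // Ideal.absNorm I = n} := fun n =>
    (Ideal.finite_setOfPred_absNorm_eq n).to_subtype
  rw [summable_sigma_of_nonneg fun _ => by simp only [Function.comp_apply]; positivity]
  refine ⟨fun n => Summable.of_finite, ?_⟩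
  refine (summable_card_absNorm_mul_rpow (K := K) ht).congr fun n => ?_
  have := Fintype.ofFinite {I : Ideal (𝓞 K) // Ideal.absNorm I = n}
  rw [tsum_fintype, Nat.card_eq_fintype_card, ← nsmul_eq_mul, ← Finset.card_univ,
    ← Finset.sum_const]
  refine Finset.sum_congr rfl fun I _ => ?_
  simp [Equiv.sigmaFiberEquiv, I.2]

lemma summable_primeNotDvdThree_rpow {t : ℝ} (ht : 1 < t) :
    Summable fun P : PrimeNotDvdThree => (Ideal.absNorm P.1.asIdeal : ℝ) ^ (-t) :=
  (summable_absNorm_rpow (K := k) ht).comp_injective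
    (i := fun P : PrimeNotDvdThree => P.1.asIdeal)
    fun _ _ h => Subtype.ext (IsDedekindDomain.HeightOneSpectrum.ext h)

lemma two_le_absNorm (P : PrimeNotDvdThree) : 2 ≤ Ideal.absNorm P.1.asIdeal := by
  have h0 : Ideal.absNorm P.1.asIdeal ≠ 0 := fun h => P.1.ne_bot (Ideal.absNorm_eq_zero_iff.1 h)
  have h1 : Ideal.absNorm P.1.asIdeal ≠ 1 := fun h =>
    P.1.isPrime.ne_top (Ideal.absNorm_eq_one_iff.1 h)
  omega

/-! ### Cube roots of unity and sums of three phases -/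

lemma zeta3_eq : zeta3 = ⟨-1 / 2, √3 / 2⟩ := by
  have h : zeta3 = Complex.exp (((2 * Real.pi / 3 : ℝ) : ℂ) * Complex.I) := by
    rw [zeta3]
    congr 1
    push_cast
    ring
  have hc : Real.cos (2 * Real.pi / 3) = -1 / 2 := by
    rw [show 2 * Real.pi / 3 = Real.pi - Real.pi / 3 by ring, Real.cos_pi_sub, Real.cos_pi_div_three]
    ring
  have hs : Real.sin (2 * Real.pi / 3) = √3 / 2 := by
    rw [show 2 * Real.pi / 3 = Real.pi - Real.pi / 3 by ring, Real.sin_pi_sub, Real.sin_pi_div_three]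
  rw [h]
  apply Complex.ext
  · rw [Complex.exp_ofReal_mul_I_re, hc]
  · rw [Complex.exp_ofReal_mul_I_im, hs]

lemma zeta3_sq_eq : zeta3 ^ 2 = ⟨-1 / 2, -(√3 / 2)⟩ := by
  have h3 : √3 * √3 = 3 := Real.mul_self_sqrt (by norm_num)
  rw [zeta3_eq, sq]
  apply Complex.ext
  · simp only [Complex.mul_re]
    linarith
  · simp only [Complex.mul_im]
    ring

lemma norm_zeta3_pow (j : ℕ) : ‖zeta3 ^ j‖ = 1 := by
  have : ‖zeta3‖ = 1 := by
    rw [zeta3, Complex.norm_exp]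
    simp
  rw [norm_pow, this, one_pow]

lemma sum_zeta3_pow : ∑ j ∈ Finset.range 3, zeta3 ^ j = 0 := by
  simp only [Finset.sum_range_succ, Finset.sum_range_zero, zero_add, pow_zero, pow_one]
  rw [zeta3_sq_eq, zeta3_eq]
  apply Complex.ext <;> simp
  norm_num

lemma norm_phase (y a : ℂ) : ‖phase y a‖ = 1 := by
  rw [phase, Complex.norm_exp]
  simp

lemma phase_eq (y a : ℂ) : phase y a =
    ⟨Real.cos (((starRingEnd ℂ) y * a).re), -Real.sin (((starRingEnd ℂ) y * a).re)⟩ := by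
  rw [phase, show -Complex.I * ((((starRingEnd ℂ) y * a).re : ℝ) : ℂ) =
    ((-((starRingEnd ℂ) y * a).re : ℝ) : ℂ) * Complex.I by push_cast; ring]
  apply Complex.ext
  · rw [Complex.exp_ofReal_mul_I_re, Real.cos_neg]
  · rw [Complex.exp_ofReal_mul_I_im, Real.sin_neg]

/-- Second-order Taylor bound for `|θ| ≤ 1`; for `|θ| ≥ 1` the trivial bound `2 + |θ| ≤ 3θ²`
suffices. -/
lemma norm_phase_sub_one_add_le (y a : ℂ) :
    ‖phase y a - 1 + Complex.I * (((starRingEnd ℂ) y * a).re : ℂ)‖ ≤ 3 * (‖y‖ * ‖a‖) ^ 2 := by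
  have hle : |((starRingEnd ℂ) y * a).re| ≤ ‖y‖ * ‖a‖ := by
    refine (Complex.abs_re_le_norm _).trans ?_
    rw [norm_mul, Complex.norm_conj]
  set θ : ℝ := ((starRingEnd ℂ) y * a).re with hθ
  have hsq : |θ| ^ 2 ≤ (‖y‖ * ‖a‖) ^ 2 := by gcongr
  have hn : ‖-Complex.I * (θ : ℂ)‖ = |θ| := by simp
  rcases le_total |θ| 1 with h | h
  · have := Complex.norm_exp_sub_one_sub_id_le (x := -Complex.I * (θ : ℂ)) (by rw [hn]; exact h)
    rw [hn] at this
    have heq : phase y a - 1 + Complex.I * (θ : ℂ) =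
        Complex.exp (-Complex.I * (θ : ℂ)) - 1 - (-Complex.I * (θ : ℂ)) := by
      rw [phase, ← hθ]
      ring
    rw [heq]
    nlinarith [sq_nonneg |θ|]
  · have h1 : ‖phase y a - 1 + Complex.I * (θ : ℂ)‖ ≤ 1 + 1 + |θ| := by
      refine (norm_add_le _ _).trans (add_le_add ((norm_sub_le _ _).trans ?_) (by simp))
      rw [norm_phase, norm_one]
    nlinarith

/-- Three unit vectors with distinct arguments have a short sum. -/
lemma normSq_sum_three_unit_le {t₀ t₁ t₂ : ℝ} (h01 : |t₀ - t₁| ≤ Real.pi)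
    (h02 : |t₀ - t₂| ≤ Real.pi) (h12 : |t₁ - t₂| ≤ Real.pi) :
    (Real.cos t₀ + Real.cos t₁ + Real.cos t₂) ^ 2 + (Real.sin t₀ + Real.sin t₁ + Real.sin t₂) ^ 2 ≤
      9 - 2 / 5 * ((t₀ - t₁) ^ 2 + (t₀ - t₂) ^ 2 + (t₁ - t₂) ^ 2) := by
  -- The squared norm is `3 + 2 ∑ cos(tᵢ - tⱼ)`, and `cos x ≤ 1 - 2x²/π²` on `[-π, π]`.
  have hπ : 1 / 5 ≤ 2 / Real.pi ^ 2 := by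
    rw [div_le_div_iff₀ (by norm_num) (by positivity)]
    nlinarith [Real.pi_lt_d2, Real.pi_pos]
  have key : ∀ x : ℝ, |x| ≤ Real.pi → Real.cos x ≤ 1 - 1 / 5 * x ^ 2 := fun x hx => by
    have := Real.cos_le_one_sub_mul_cos_sq hx
    nlinarith [mul_le_mul_of_nonneg_right hπ (sq_nonneg x)]
  have k01 := key _ h01
  have k02 := key _ h02
  have k12 := key _ h12
  rw [Real.cos_sub] at k01 k02 k12
  nlinarith [Real.sin_sq_add_cos_sq t₀, Real.sin_sq_add_cos_sq t₁, Real.sin_sq_add_cos_sq t₂]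

lemma sq_half_sub_sq_le (a b : ℝ) : a ^ 2 / 2 - b ^ 2 ≤ (a + b) ^ 2 := by
  nlinarith [sq_nonneg (a + 2 * b)]

/-- The mean of the three phases is bounded away from `1` when the `a_j` are close to `ζ₃^j c`. -/
lemma norm_sum_phase_le {y c : ℂ} {a : ℕ → ℂ}
    (ha : ∀ j < 3, ‖a j - zeta3 ^ j * c‖ ≤ 3 / 10 * ‖c‖) (hu : ‖y‖ * ‖c‖ ≤ 1 / 2) :
    ‖∑ j ∈ Finset.range 3, phase y (a j)‖ ≤ 3 - 3 / 50 * (‖y‖ * ‖c‖) ^ 2 := by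
  have h3 : √3 * √3 = 3 := Real.mul_self_sqrt (by norm_num)
  set v : ℂ := (starRingEnd ℂ) y * c with hv
  have hvn : ‖v‖ = ‖y‖ * ‖c‖ := by rw [hv, norm_mul, Complex.norm_conj]
  have hvsq : v.re ^ 2 + v.im ^ 2 = ‖v‖ ^ 2 := by
    rw [← Complex.normSq_eq_norm_sq, Complex.normSq_apply]
    ring
  set e : ℕ → ℝ := fun j => ((starRingEnd ℂ) y * (a j - zeta3 ^ j * c)).re with he
  have hebd : ∀ j < 3, |e j| ≤ 3 / 10 * ‖v‖ := fun j hj => by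
    refine (Complex.abs_re_le_norm _).trans ?_
    rw [norm_mul, Complex.norm_conj, hvn]
    nlinarith [ha j hj, norm_nonneg y]
  have hθ : ∀ j, ((starRingEnd ℂ) y * a j).re = (v * zeta3 ^ j).re + e j := fun j => by
    rw [he, ← Complex.add_re, hv]
    congr 1
    ring
  have hx : ∀ j, |(v * zeta3 ^ j).re| ≤ ‖v‖ := fun j => by
    refine (Complex.abs_re_le_norm _).trans ?_
    rw [norm_mul, norm_zeta3_pow, mul_one]
  rw [← hvn] at hu ⊢
  have hdiff : ∀ i < 3, ∀ j < 3,
      |((starRingEnd ℂ) y * a i).re - ((starRingEnd ℂ) y * a j).re| ≤ Real.pi := fun i hi j hj => by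
    rw [hθ, hθ]
    have := abs_le.1 (hx i)
    have := abs_le.1 (hx j)
    have := abs_le.1 (hebd i hi)
    have := abs_le.1 (hebd j hj)
    rw [abs_le]
    constructor <;> linarith [Real.pi_gt_three]
  have hmain := normSq_sum_three_unit_le (hdiff 0 (by norm_num) 1 (by norm_num))
    (hdiff 0 (by norm_num) 2 (by norm_num)) (hdiff 1 (by norm_num) 2 (by norm_num))
  have hsq : ‖∑ j ∈ Finset.range 3, phase y (a j)‖ ^ 2 ≤ 9 - 2 / 5 * ‖v‖ ^ 2 := by
    rw [← Complex.normSq_eq_norm_sq, Complex.normSq_apply]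
    simp only [Finset.sum_range_succ, Finset.sum_range_zero, zero_add, Complex.add_re,
      Complex.add_im, phase_eq]
    -- The unperturbed squared differences sum to `9/2 ‖v‖²` for every argument of `v`. Half of this
    -- survives, minus `3 · (3/5)² ‖v‖²` for the errors: `9/4 - 27/25 > 1`.
    have hlow : ‖v‖ ^ 2 ≤
        (((starRingEnd ℂ) y * a 0).re - ((starRingEnd ℂ) y * a 1).re) ^ 2 +
        (((starRingEnd ℂ) y * a 0).re - ((starRingEnd ℂ) y * a 2).re) ^ 2 +
        (((starRingEnd ℂ) y * a 1).re - ((starRingEnd ℂ) y * a 2).re) ^ 2 := by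
      simp only [hθ]
      have hx0 : (v * zeta3 ^ 0).re = v.re := by simp
      have hx1 : (v * zeta3 ^ 1).re = -v.re / 2 - √3 / 2 * v.im := by
        rw [pow_one, zeta3_eq, Complex.mul_re]
        ring
      have hx2 : (v * zeta3 ^ 2).re = -v.re / 2 + √3 / 2 * v.im := by
        rw [zeta3_sq_eq, Complex.mul_re]
        ring
      rw [hx0, hx1, hx2]
      have hee : ∀ i < 3, ∀ j < 3, (e i - e j) ^ 2 ≤ (3 / 5 * ‖v‖) ^ 2 := fun i hi j hj => by
        have := abs_le.1 (hebd i hi)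
        have := abs_le.1 (hebd j hj)
        refine sq_le_sq' ?_ ?_ <;> linarith
      have e01 := hee 0 (by norm_num) 1 (by norm_num)
      have e02 := hee 0 (by norm_num) 2 (by norm_num)
      have e12 := hee 1 (by norm_num) 2 (by norm_num)
      have s01 := sq_half_sub_sq_le (v.re - (-v.re / 2 - √3 / 2 * v.im)) (e 0 - e 1)
      have s02 := sq_half_sub_sq_le (v.re - (-v.re / 2 + √3 / 2 * v.im)) (e 0 - e 2)
      have s12 := sq_half_sub_sq_le
        ((-v.re / 2 - √3 / 2 * v.im) - (-v.re / 2 + √3 / 2 * v.im)) (e 1 - e 2)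
      have hid : (v.re - (-v.re / 2 - √3 / 2 * v.im)) ^ 2 +
          (v.re - (-v.re / 2 + √3 / 2 * v.im)) ^ 2 +
          ((-v.re / 2 - √3 / 2 * v.im) - (-v.re / 2 + √3 / 2 * v.im)) ^ 2 =
          9 / 2 * ‖v‖ ^ 2 := by
        rw [← hvsq]
        linear_combination (3 / 2 * v.im ^ 2) * h3
      have t01 : v.re + e 0 - (-v.re / 2 - √3 / 2 * v.im + e 1) =
        v.re - (-v.re / 2 - √3 / 2 * v.im) + (e 0 - e 1) := by ring
      have t02 : v.re + e 0 - (-v.re / 2 + √3 / 2 * v.im + e 2) =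
        v.re - (-v.re / 2 + √3 / 2 * v.im) + (e 0 - e 2) := by ring
      have t12 : -v.re / 2 - √3 / 2 * v.im + e 1 - (-v.re / 2 + √3 / 2 * v.im + e 2) =
        (-v.re / 2 - √3 / 2 * v.im) - (-v.re / 2 + √3 / 2 * v.im) + (e 1 - e 2) := by ring
      rw [t01, t02, t12]
      nlinarith [sq_nonneg ‖v‖]
    linarith
  -- With `t = ‖v‖²`: `(3 - 3t/50)² ≥ 9 - 9t/25 ≥ 9 - 2t/5`.
  refine abs_le_of_sq_le_sq' ?_ ?_ |>.2
  · nlinarith [sq_nonneg (‖v‖ ^ 2), sq_nonneg ‖v‖]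
  · nlinarith [norm_nonneg v]

/-! ### Bounds for the Euler factors and convergence of the product -/

lemma norm_eulerFactor_le (a : ℕ → ℕ → ℂ) (y : ℂ) (P : PrimeNotDvdThree) :
    ‖eulerFactor a y P‖ ≤
      1 / ((Ideal.absNorm P.1.asIdeal : ℝ) + 1) +
        1 / 3 * ((Ideal.absNorm P.1.asIdeal : ℝ) / ((Ideal.absNorm P.1.asIdeal : ℝ) + 1)) *
          ‖∑ j ∈ Finset.range 3, phase y (a (Ideal.absNorm P.1.asIdeal) j)‖ := by
  set N := Ideal.absNorm P.1.asIdeal with hN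
  have h1 : ‖(N : ℂ) + 1‖ = N + 1 := by exact_mod_cast Complex.norm_natCast (N + 1)
  refine (norm_add_le _ _).trans_eq ?_
  rw [norm_mul, norm_mul, norm_div, norm_div, norm_div, h1]
  simp [← hN]

lemma norm_eulerFactor_le_one (a : ℕ → ℕ → ℂ) (y : ℂ) (P : PrimeNotDvdThree) :
    ‖eulerFactor a y P‖ ≤ 1 := by
  refine (norm_eulerFactor_le a y P).trans ?_
  set N := Ideal.absNorm P.1.asIdeal
  have h3 : ‖∑ j ∈ Finset.range 3, phase y (a N j)‖ ≤ 3 := by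
    refine (norm_sum_le _ _).trans ?_
    simp [norm_phase]
  calc 1 / ((N : ℝ) + 1) + 1 / 3 * ((N : ℝ) / ((N : ℝ) + 1)) *
        ‖∑ j ∈ Finset.range 3, phase y (a N j)‖
      ≤ 1 / ((N : ℝ) + 1) + 1 / 3 * ((N : ℝ) / ((N : ℝ) + 1)) * 3 := by gcongr
    _ = 1 := by field_simp; ring

/-- The phases carry weight `N/(N+1) ≥ 1/2`, so the saving is at least `1/3 · 1/2 · 3/50 = 1/100`
times `(‖y‖‖c‖)²`. -/
lemma norm_eulerFactor_le_exp {a : ℕ → ℕ → ℂ} {y : ℂ} {P : PrimeNotDvdThree} {c : ℂ}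
    (ha : ∀ j < 3, ‖a (Ideal.absNorm P.1.asIdeal) j - zeta3 ^ j * c‖ ≤ 3 / 10 * ‖c‖)
    (hu : ‖y‖ * ‖c‖ ≤ 1 / 2) :
    ‖eulerFactor a y P‖ ≤ Real.exp (-(1 / 100 * (‖y‖ * ‖c‖) ^ 2)) := by
  refine (norm_eulerFactor_le a y P).trans ?_
  have hN := two_le_absNorm P
  have h3 := norm_sum_phase_le ha hu
  set N := Ideal.absNorm P.1.asIdeal
  have hN' : (2 : ℝ) ≤ N := by exact_mod_cast hN
  have hhalf : 1 / 2 ≤ (N : ℝ) / (N + 1) := by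
    rw [div_le_div_iff₀ (by norm_num) (by linarith)]
    linarith
  have hone : 1 / ((N : ℝ) + 1) = 1 - (N : ℝ) / (N + 1) := by field_simp; ring
  have hexp := Real.add_one_le_exp (-(1 / 100 * (‖y‖ * ‖c‖) ^ 2))
  rw [hone]
  nlinarith [sq_nonneg (‖y‖ * ‖c‖)]

lemma norm_tprod_le_of_norm_le_one {ι : Type*} {f : ι → ℂ} (hf : Multipliable f)
    (h1 : ∀ i, ‖f i‖ ≤ 1) (S : Finset ι) : ‖∏' i, f i‖ ≤ ∏ i ∈ S, ‖f i‖ := by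
  classical
  refine le_of_tendsto hf.hasProd.norm (Filter.eventually_atTop.2 ⟨S, fun T hT => ?_⟩)
  rw [← Finset.prod_sdiff hT]
  exact mul_le_of_le_one_left (Finset.prod_nonneg fun _ _ => norm_nonneg _)
    (Finset.prod_le_one (fun _ _ => norm_nonneg _) fun i _ => h1 i)

/-- Unconditional convergence of the product, for coefficients `a_{N,j} = ζ₃^j c_N + O(|c_N| N^{-σ})`
with `c_N = O(N^{-τ})` and `τ > 1/2`. -/
lemma multipliable_eulerFactor {a : ℕ → ℕ → ℂ} {c : ℕ → ℂ} {σ τ D E : ℝ}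
    (hτ : 1 / 2 < τ) (hτσ : τ ≤ σ) (hD : 0 ≤ D)
    (ha : ∀ N : ℕ, 2 ≤ N → ∀ j < 3, ‖a N j - zeta3 ^ j * c N‖ ≤ D * ‖c N‖ * (N : ℝ) ^ (-σ))
    (hc : ∀ N : ℕ, 2 ≤ N → ‖c N‖ ≤ E * (N : ℝ) ^ (-τ)) (y : ℂ) :
    Multipliable (eulerFactor a y) := by
  have hE : 0 ≤ E := by
    by_contra hE
    have := (norm_nonneg _).trans (hc 2 le_rfl)
    have h2 : (0 : ℝ) < (2 : ℕ) ^ (-τ) := by positivity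
    nlinarith
  have hsum := (summable_primeNotDvdThree_rpow (t := 2 * τ) (by linarith)).mul_left
    (9 * (‖y‖ * ((1 + D) * E)) ^ 2 + 3 * (‖y‖ * (D * E)))
  suffices h : Multipliable fun P => 1 + (eulerFactor a y P - 1) by
    simpa using h
  refine multipliable_one_add_of_summable (hsum.of_nonneg_of_le (fun _ => norm_nonneg _) fun P => ?_)
  have hN := two_le_absNorm P
  set N := Ideal.absNorm P.1.asIdeal with hNdef
  have hN1 : (1 : ℝ) ≤ N := by exact_mod_cast (by omega : 1 ≤ N)
  have hN0 : (0 : ℝ) < N := by linarith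
  have hcN := hc N hN
  have hσ1 : (N : ℝ) ^ (-σ) ≤ 1 := Real.rpow_le_one_of_one_le_of_nonpos hN1 (by linarith)
  have hστ : (N : ℝ) ^ (-σ) ≤ (N : ℝ) ^ (-τ) := Real.rpow_le_rpow_of_exponent_le hN1 (by linarith)
  have hpos : 0 < (N : ℝ) ^ (-τ) := by positivity
  have hposσ : 0 < (N : ℝ) ^ (-σ) := by positivity
  have hsq : (N : ℝ) ^ (-(2 * τ)) = ((N : ℝ) ^ (-τ)) ^ 2 := by
    rw [← Real.rpow_natCast, ← Real.rpow_mul hN0.le]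
    congr 1
    push_cast
    ring
  have hr : ∀ j < 3, ‖a N j - zeta3 ^ j * c N‖ ≤ D * E * ((N : ℝ) ^ (-τ)) ^ 2 := fun j hj => by
    refine (ha N hN j hj).trans ?_
    calc D * ‖c N‖ * (N : ℝ) ^ (-σ) ≤ D * (E * (N : ℝ) ^ (-τ)) * (N : ℝ) ^ (-τ) := by gcongr
      _ = _ := by ring
  have hanorm : ∀ j < 3, ‖a N j‖ ≤ (1 + D) * E * (N : ℝ) ^ (-τ) := fun j hj => by
    have h1 : ‖a N j‖ ≤ ‖a N j - zeta3 ^ j * c N‖ + ‖zeta3 ^ j * c N‖ := by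
      simpa using norm_add_le (a N j - zeta3 ^ j * c N) (zeta3 ^ j * c N)
    rw [norm_mul, norm_zeta3_pow, one_mul] at h1
    have h2 : D * ‖c N‖ * (N : ℝ) ^ (-σ) ≤ D * ‖c N‖ :=
      mul_le_of_le_one_right (by positivity) hσ1
    calc ‖a N j‖ ≤ (1 + D) * ‖c N‖ := by linarith [ha N hN j hj]
      _ ≤ (1 + D) * (E * (N : ℝ) ^ (-τ)) := by gcongr
      _ = _ := by ring
  -- Because `∑ ζ₃^j = 0`, subtracting `ζ₃^j c_N` in the linear term changes nothing and leaves only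
  -- the approximation error.
  have hdecomp : ∑ j ∈ Finset.range 3, (phase y (a N j) - 1) =
      ∑ j ∈ Finset.range 3, (phase y (a N j) - 1 + Complex.I * (((starRingEnd ℂ) y * a N j).re : ℂ)) -
      Complex.I * (((starRingEnd ℂ) y * ∑ j ∈ Finset.range 3, (a N j - zeta3 ^ j * c N)).re : ℂ) := by
    rw [Finset.sum_sub_distrib (f := fun j => a N j), ← Finset.sum_mul, sum_zeta3_pow, zero_mul,
      sub_zero, Finset.mul_sum, Complex.re_sum, Complex.ofReal_sum, Finset.mul_sum,
      ← Finset.sum_sub_distrib]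
    simp
  have hbound : ‖∑ j ∈ Finset.range 3, (phase y (a N j) - 1)‖ ≤
      (9 * (‖y‖ * ((1 + D) * E)) ^ 2 + 3 * (‖y‖ * (D * E))) * ((N : ℝ) ^ (-τ)) ^ 2 := by
    rw [hdecomp]
    refine (norm_sub_le _ _).trans ?_
    rw [add_mul]
    refine add_le_add ?_ ?_
    · refine (norm_sum_le_of_le _ (f := fun j => phase y (a N j) - 1 +
        Complex.I * (((starRingEnd ℂ) y * a N j).re : ℂ))
        (n := fun _ => 3 * (‖y‖ * ((1 + D) * E * (N : ℝ) ^ (-τ))) ^ 2) fun j hj => ?_).trans_eq ?_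
      · refine (norm_phase_sub_one_add_le y (a N j)).trans ?_
        have := hanorm j (Finset.mem_range.1 hj)
        gcongr
      · simp only [Finset.sum_const, Finset.card_range, nsmul_eq_mul]
        push_cast
        ring
    · rw [norm_mul, Complex.norm_I, one_mul, Complex.norm_real, Real.norm_eq_abs]
      refine (Complex.abs_re_le_norm _).trans ?_
      rw [norm_mul, Complex.norm_conj]
      have := norm_sum_le_of_le (Finset.range 3) (f := fun j => a N j - zeta3 ^ j * c N)
        (n := fun _ => D * E * ((N : ℝ) ^ (-τ)) ^ 2) fun j hj => hr j (Finset.mem_range.1 hj)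
      simp only [Finset.sum_const, Finset.card_range, nsmul_eq_mul] at this
      push_cast at this
      calc ‖y‖ * ‖∑ j ∈ Finset.range 3, (a N j - zeta3 ^ j * c N)‖
          ≤ ‖y‖ * (3 * (D * E * ((N : ℝ) ^ (-τ)) ^ 2)) := by gcongr
        _ = _ := by ring
  have hC : (N : ℂ) + 1 ≠ 0 := by exact_mod_cast (Nat.succ_ne_zero N)
  have hfac : eulerFactor a y P - 1 = ((1 / 3 * ((N : ℝ) / (N + 1)) : ℝ) : ℂ) *
      ∑ j ∈ Finset.range 3, (phase y (a N j) - 1) := by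
    rw [eulerFactor, ← hNdef, Finset.sum_sub_distrib]
    simp only [Finset.sum_const, Finset.card_range, nsmul_eq_mul]
    push_cast
    field_simp
    ring
  rw [hfac, norm_mul, Complex.norm_real, hsq]
  refine (mul_le_of_le_one_left (norm_nonneg _) ?_).trans hbound
  have : (N : ℝ) / (N + 1) ≤ 1 := div_le_one_of_le₀ (by linarith) (by linarith)
  rw [Real.norm_of_nonneg (by positivity)]
  linarith

/-- Decay of the product from the primes `p ≡ 1 (mod 3)` in `(X, BX]`. -/
lemma exists_norm_charProduct_le :
    ∃ B : ℝ, 1 < B ∧ ∀ (a : ℕ → ℕ → ℂ) (c : ℕ → ℂ) (y : ℂ) (X u : ℝ),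
      Multipliable (eulerFactor a y) → 1 ≤ X → 0 ≤ u →
      (∀ N : ℕ, X ≤ N → (N : ℝ) ≤ B * X →
        (∀ j < 3, ‖a N j - zeta3 ^ j * c N‖ ≤ 3 / 10 * ‖c N‖) ∧
        u ≤ ‖y‖ * ‖c N‖ ∧ ‖y‖ * ‖c N‖ ≤ 1 / 2) →
      ‖charProduct a y‖ ≤ Real.exp (-(u ^ 2 / 100 * (X / Real.log (B * X)))) := by
  obtain ⟨B, hB, hcard⟩ := exists_card_primes_one_mod_three_ge
  refine ⟨B, hB, fun a c y X u hmul hX hu hyp => ?_⟩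
  classical
  set S := {p ∈ Finset.Ioc ⌊X⌋₊ ⌊B * X⌋₊ | p.Prime ∧ p % 3 = 1} with hS
  have hex : ∀ p : S, ∃ P : PrimeNotDvdThree, Ideal.absNorm P.1.asIdeal = p := fun p =>
    exists_primeNotDvdThree_absNorm_eq (Finset.mem_filter.1 p.2).2.1 (Finset.mem_filter.1 p.2).2.2
  choose Q hQ using hex
  have hinj : Function.Injective Q := fun p q h => Subtype.ext (by rw [← hQ p, ← hQ q, h])
  have hlog : 0 < Real.log (B * X) := Real.log_pos (by nlinarith)
  have hXS : X / Real.log (B * X) ≤ (S.card : ℝ) := by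
    rw [div_le_iff₀ hlog]
    linarith [hcard X hX]
  rw [charProduct, norm_mul, norm_phase, one_mul]
  refine (norm_tprod_le_of_norm_le_one hmul (norm_eulerFactor_le_one a y)
    (Finset.univ.image Q)).trans ?_
  rw [Finset.prod_image hinj.injOn]
  calc ∏ p : S, ‖eulerFactor a y (Q p)‖
      ≤ ∏ _p : S, Real.exp (-(u ^ 2 / 100)) := by
        refine Finset.prod_le_prod (fun _ _ => norm_nonneg _) fun p _ => ?_
        obtain ⟨hp1, hp2⟩ := Finset.mem_Ioc.1 (Finset.mem_filter.1 p.2).1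
        have hXp : X ≤ (p : ℕ) := ((Nat.floor_lt (by linarith)).1 hp1).le
        have hpB : ((p : ℕ) : ℝ) ≤ B * X := (Nat.le_floor_iff (by nlinarith)).1 hp2
        obtain ⟨h1, h2, h3⟩ := hyp p hXp hpB
        rw [← hQ p] at h1
        refine (norm_eulerFactor_le_exp (c := c (Ideal.absNorm (Q p).1.asIdeal)) h1
          (by rw [hQ p]; exact h3)).trans (Real.exp_le_exp.2 ?_)
        rw [hQ p]
        nlinarith
    _ = Real.exp (-(u ^ 2 / 100 * (S.card : ℝ))) := by
        rw [Finset.prod_const, Finset.card_univ, Fintype.card_coe, ← Real.exp_nat_mul]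
        congr 1
        ring
    _ ≤ _ := Real.exp_le_exp.2 (neg_le_neg (by gcongr))

/-! ### The coefficients in the two cases -/

lemma norm_zeta3_pow_mul_cpow {s : ℂ} {N : ℕ} (hN : 2 ≤ N) (j : ℕ) :
    ‖zeta3 ^ j * (N : ℂ) ^ (-s)‖ = (N : ℝ) ^ (-s.re) := by
  rw [norm_mul, norm_zeta3_pow, one_mul, Complex.norm_natCast_cpow_of_pos (by omega),
    Complex.neg_re]

/-- Keeps `|1 - ζ₃^j N^{-s}| ≥ 1/4`, the source of the constant `4` in both approximations. -/
lemma rpow_neg_le_three_quarters {σ : ℝ} (hσ : 1 / 2 < σ) {N : ℕ} (hN : 2 ≤ N) :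
    (N : ℝ) ^ (-σ) ≤ 3 / 4 := by
  have hN' : (2 : ℝ) ≤ N := by exact_mod_cast hN
  calc (N : ℝ) ^ (-σ) ≤ (N : ℝ) ^ (-(1 / 2) : ℝ) :=
        Real.rpow_le_rpow_of_exponent_le (by linarith) (by linarith)
    _ ≤ (2 : ℝ) ^ (-(1 / 2) : ℝ) :=
        Real.rpow_le_rpow_of_nonpos (by norm_num) hN' (by norm_num)
    _ = (√2)⁻¹ := by rw [Real.rpow_neg (by norm_num), ← Real.sqrt_eq_rpow]
    _ ≤ 3 / 4 := by
        rw [inv_le_comm₀ (by positivity) (by norm_num)]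
        exact Real.le_sqrt_of_sq_le (by norm_num)

/-- First-order approximation of `log (1 - ζ₃^j N^{-s})`. -/
lemma norm_aLog_sub_le {s : ℂ} (hs : 1 / 2 < s.re) {N : ℕ} (hN : 2 ≤ N) (j : ℕ) :
    ‖aLog s N j - zeta3 ^ j * -(N : ℂ) ^ (-s)‖ ≤
      4 * ‖-(N : ℂ) ^ (-s)‖ * (N : ℝ) ^ (-s.re) := by
  have hz := norm_zeta3_pow_mul_cpow (s := s) hN j
  have h34 := rpow_neg_le_three_quarters hs hN
  have hpos : 0 ≤ (N : ℝ) ^ (-s.re) := by positivity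
  have h := Complex.norm_log_one_add_sub_self_le (z := -(zeta3 ^ j * (N : ℂ) ^ (-s)))
    (by rw [norm_neg, hz]; linarith)
  rw [norm_neg, hz] at h
  have hinv : (1 - (N : ℝ) ^ (-s.re))⁻¹ ≤ 4 := by
    rw [inv_le_comm₀ (by linarith) (by norm_num)]
    linarith
  rw [norm_neg, Complex.norm_natCast_cpow_of_pos (by omega), Complex.neg_re, aLog, mul_neg,
    sub_eq_add_neg 1]
  refine h.trans ?_
  nlinarith [mul_le_mul_of_nonneg_left hinv (sq_nonneg ((N : ℝ) ^ (-s.re)))]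

/-- First-order approximation of `ζ₃^j log N / (N^s - ζ₃^j)`. -/
lemma norm_aLogDeriv_sub_le {s : ℂ} (hs : 1 / 2 < s.re) {N : ℕ} (hN : 2 ≤ N) (j : ℕ) :
    ‖aLogDeriv s N j - zeta3 ^ j * ((Real.log N : ℂ) * (N : ℂ) ^ (-s))‖ ≤
      4 * ‖(Real.log N : ℂ) * (N : ℂ) ^ (-s)‖ * (N : ℝ) ^ (-s.re) := by
  have hz := norm_zeta3_pow_mul_cpow (s := s) hN j
  have h34 := rpow_neg_le_three_quarters hs hN
  have hpos : 0 ≤ (N : ℝ) ^ (-s.re) := by positivity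
  set w := zeta3 ^ j * (N : ℂ) ^ (-s) with hw
  have hlow : 1 / 4 ≤ ‖1 - w‖ := by
    have := norm_sub_norm_le 1 w
    rw [norm_one, hz] at this
    linarith
  have hw0 : 1 - w ≠ 0 := fun h => by
    rw [h, norm_zero] at hlow
    norm_num at hlow
  have hN0 : (N : ℂ) ≠ 0 := by exact_mod_cast (by omega : N ≠ 0)
  have hNs : (N : ℂ) ^ s ≠ 0 := by simp [Complex.cpow_eq_zero_iff, hN0]
  have hneg : (N : ℂ) ^ (-s) = ((N : ℂ) ^ s)⁻¹ := Complex.cpow_neg _ _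
  have hden : (N : ℂ) ^ s - zeta3 ^ j = (N : ℂ) ^ s * (1 - w) := by
    rw [hw, hneg]
    field_simp
  have heq : aLogDeriv s N j - zeta3 ^ j * ((Real.log N : ℂ) * (N : ℂ) ^ (-s)) =
      zeta3 ^ j * ((Real.log N : ℂ) * (N : ℂ) ^ (-s)) * (w / (1 - w)) := by
    rw [aLogDeriv, hden, hneg]
    field_simp
    ring
  rw [heq, norm_mul, norm_mul, norm_zeta3_pow, one_mul, norm_div, hz]
  have hq : (N : ℝ) ^ (-s.re) / ‖1 - w‖ ≤ 4 * (N : ℝ) ^ (-s.re) := by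
    rw [div_le_iff₀ (by linarith)]
    nlinarith
  calc ‖(Real.log N : ℂ) * (N : ℂ) ^ (-s)‖ * ((N : ℝ) ^ (-s.re) / ‖1 - w‖)
      ≤ ‖(Real.log N : ℂ) * (N : ℂ) ^ (-s)‖ * (4 * (N : ℝ) ^ (-s.re)) := by gcongr
    _ = _ := by ring

lemma norm_log_mul_cpow {s : ℂ} {N : ℕ} (hN : 0 < N) :
    ‖(Real.log N : ℂ) * (N : ℂ) ^ (-s)‖ = Real.log N * (N : ℝ) ^ (-s.re) := by
  rw [norm_mul, Complex.norm_real, Real.norm_of_nonneg (Real.log_natCast_nonneg N),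
    Complex.norm_natCast_cpow_of_pos hN, Complex.neg_re]

lemma multipliable_eulerFactor_aLog {s : ℂ} (hs : 1 / 2 < s.re) (y : ℂ) :
    Multipliable (eulerFactor (aLog s) y) := by
  refine multipliable_eulerFactor (c := fun N => -(N : ℂ) ^ (-s)) (D := 4) (E := 1) hs le_rfl
    (by norm_num) (fun N hN j _ => norm_aLog_sub_le hs hN j) (fun N hN => ?_) y
  rw [norm_neg, Complex.norm_natCast_cpow_of_pos (by omega), Complex.neg_re, one_mul]

lemma multipliable_eulerFactor_aLogDeriv {s : ℂ} (hs : 1 / 2 < s.re) (y : ℂ) :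
    Multipliable (eulerFactor (aLogDeriv s) y) := by
  -- The factor `log N` costs a small power of `N`, so `τ` is taken halfway between `1/2` and `Re
  -- s`.
  refine multipliable_eulerFactor (c := fun N => (Real.log N : ℂ) * (N : ℂ) ^ (-s)) (σ := s.re)
    (τ := (s.re + 1 / 2) / 2) (D := 4) (E := ((s.re - 1 / 2) / 2)⁻¹) (by linarith) (by linarith)
    (by norm_num) (fun N hN j _ => norm_aLogDeriv_sub_le hs hN j) (fun N hN => ?_) y
  have hN0 : (0 : ℝ) < N := by exact_mod_cast (by omega : 0 < N)
  rw [norm_log_mul_cpow (by omega)]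
  have h := Real.log_le_rpow_div (x := N) (ε := (s.re - 1 / 2) / 2) hN0.le (by linarith)
  calc Real.log N * (N : ℝ) ^ (-s.re)
      ≤ (N : ℝ) ^ ((s.re - 1 / 2) / 2) / ((s.re - 1 / 2) / 2) * (N : ℝ) ^ (-s.re) := by gcongr
    _ = ((s.re - 1 / 2) / 2)⁻¹ * ((N : ℝ) ^ ((s.re - 1 / 2) / 2) * (N : ℝ) ^ (-s.re)) := by ring
    _ = _ := by
      rw [← Real.rpow_add hN0]
      congr 2
      ring

/-! ### Choice of `X` and the decay estimates -/

lemma eventually_le_log_norm (M : ℝ) :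
    ∀ᶠ y : ℂ in Bornology.cobounded ℂ, M ≤ Real.log ‖y‖ :=
  (Real.tendsto_log_atTop.comp tendsto_norm_cobounded_atTop).eventually_ge_atTop M

/-- Comparison of `N^{-σ}` with `X^{-σ}` for `N ∈ [X, BX]`. -/
lemma rpow_neg_bounds {σ B X N : ℝ} (hσ : 0 < σ) (hB : 0 < B) (hX : 0 < X) (hXN : X ≤ N)
    (hNB : N ≤ B * X) :
    B ^ (-σ) * X ^ (-σ) ≤ N ^ (-σ) ∧ N ^ (-σ) ≤ X ^ (-σ) := by
  constructor
  · rw [← Real.mul_rpow hB.le hX.le]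
    exact Real.rpow_le_rpow_of_nonpos (by linarith) hNB (by linarith)
  · exact Real.rpow_le_rpow_of_nonpos hX hXN (by linarith)

lemma exists_norm_MtildeLog_le {σ : ℝ} (hσ : 1 / 2 < σ) :
    ∃ C : ℝ, 0 < C ∧ ∀ s : ℂ, s.re = σ → ∀ᶠ y : ℂ in Bornology.cobounded ℂ,
      ‖MtildeLog s y‖ ≤ Real.exp (-C * ‖y‖ ^ (1 / σ) * (Real.log ‖y‖)⁻¹) := by
  obtain ⟨B, hB, hmain⟩ := exists_norm_charProduct_le
  have hσ0 : 0 < σ := by linarith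
  have hB0 : 0 < B := by linarith
  have hlogB : 0 < Real.log B := Real.log_pos hB
  have hlog2 : 0 < Real.log 2 := Real.log_pos (by norm_num)
  set u : ℝ := B ^ (-σ) / 2 with hu
  have hu0 : 0 < u := by positivity
  set A : ℝ := Real.log B + (1 + Real.log 2) / σ with hA
  have hA0 : 0 < A := by positivity
  refine ⟨u ^ 2 / 100 / A, by positivity, fun s hs => ?_⟩
  have hs2 : 1 / 2 < s.re := by rw [hs]; exact hσ
  filter_upwards [eventually_le_log_norm 1,
    tendsto_norm_cobounded_atTop.eventually_ge_atTop (20 : ℝ)] with y hl hy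
  have hy0 : 0 < ‖y‖ := by linarith
  -- Makes `‖y‖ X^{-σ} = 1/2`, so `‖y‖ N^{-σ}` stays between `u = B^{-σ}/2` and `1/2` on `[X, BX]`.
  set X : ℝ := (2 * ‖y‖) ^ (1 / σ) with hXdef
  have hX1 : 1 ≤ X := Real.one_le_rpow (by linarith) (by positivity)
  have hX0 : 0 < X := by linarith
  have hXσ : X ^ (-σ) = (2 * ‖y‖)⁻¹ := by
    rw [hXdef, ← Real.rpow_mul (by positivity), show 1 / σ * -σ = -1 by field_simp,
      Real.rpow_neg_one]
  refine (hmain (aLog s) (fun N => -(N : ℂ) ^ (-s)) y X u (multipliable_eulerFactor_aLog hs2 y)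
    hX1 hu0.le fun N hXN hNB => ?_).trans (Real.exp_le_exp.2 ?_)
  · obtain ⟨hlow, hup⟩ := rpow_neg_bounds hσ0 hB0 hX0 hXN hNB
    rw [hXσ] at hlow hup
    have hN1 : (1 : ℝ) < N := by
      refine lt_of_lt_of_le ?_ hXN
      exact Real.one_lt_rpow (by linarith) (by positivity)
    have hN2 : 2 ≤ N := by exact_mod_cast hN1
    have hc : ‖-(N : ℂ) ^ (-s)‖ = (N : ℝ) ^ (-σ) := by
      rw [norm_neg, Complex.norm_natCast_cpow_of_pos (by omega), Complex.neg_re, hs]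
    refine ⟨fun j _ => (norm_aLog_sub_le hs2 hN2 j).trans ?_, ?_, ?_⟩
    · have h40 : (N : ℝ) ^ (-s.re) ≤ 1 / 40 := by
        rw [hs]
        refine hup.trans ?_
        rw [inv_le_comm₀ (by positivity) (by norm_num)]
        linarith
      nlinarith [norm_nonneg (-(N : ℂ) ^ (-s))]
    · rw [hc]
      calc u = ‖y‖ * (B ^ (-σ) * (2 * ‖y‖)⁻¹) := by rw [hu]; field_simp
        _ ≤ _ := by gcongr
    · rw [hc]
      calc ‖y‖ * (N : ℝ) ^ (-σ) ≤ ‖y‖ * (2 * ‖y‖)⁻¹ := by gcongr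
        _ = 1 / 2 := by field_simp
  · have hlogX : Real.log (B * X) ≤ A * Real.log ‖y‖ := by
      rw [Real.log_mul hB0.ne' hX0.ne', hXdef, Real.log_rpow (by positivity),
        Real.log_mul (by norm_num) hy0.ne', hA]
      have h1 : Real.log B ≤ Real.log B * Real.log ‖y‖ := le_mul_of_one_le_right hlogB.le hl
      have h2 : Real.log 2 ≤ Real.log 2 * Real.log ‖y‖ := le_mul_of_one_le_right hlog2.le hl
      have h3 : 1 / σ * (Real.log 2 + Real.log ‖y‖) ≤
          1 / σ * (Real.log 2 * Real.log ‖y‖ + Real.log ‖y‖) := by gcongr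
      calc Real.log B + 1 / σ * (Real.log 2 + Real.log ‖y‖)
          ≤ Real.log B * Real.log ‖y‖ +
            1 / σ * (Real.log 2 * Real.log ‖y‖ + Real.log ‖y‖) := add_le_add h1 h3
        _ = _ := by ring
    have hlog0 : 0 < Real.log (B * X) := Real.log_pos (by nlinarith)
    have hXy : ‖y‖ ^ (1 / σ) ≤ X := Real.rpow_le_rpow hy0.le (by linarith) (by positivity)
    have hfin : ‖y‖ ^ (1 / σ) / (A * Real.log ‖y‖) ≤ X / Real.log (B * X) :=
      div_le_div₀ hX0.le hXy hlog0 hlogX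
    calc -(u ^ 2 / 100 * (X / Real.log (B * X)))
        ≤ -(u ^ 2 / 100 * (‖y‖ ^ (1 / σ) / (A * Real.log ‖y‖))) :=
          neg_le_neg (by gcongr)
      _ = _ := by
        rw [div_eq_mul_inv _ (A * _), mul_inv]
        ring

lemma exists_norm_MtildeLogDeriv_le {σ : ℝ} (hσ : 1 / 2 < σ) :
    ∃ C : ℝ, 0 < C ∧ ∀ s : ℂ, s.re = σ → ∀ᶠ y : ℂ in Bornology.cobounded ℂ,
      ‖MtildeLogDeriv s y‖ ≤
        Real.exp (-C * ‖y‖ ^ (1 / σ) * Real.log ‖y‖ ^ (1 / σ - 1)) := by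
  obtain ⟨B, hB, hmain⟩ := exists_norm_charProduct_le
  have hσ0 : 0 < σ := by linarith
  have hB0 : 0 < B := by linarith
  have hlogB : 0 < Real.log B := Real.log_pos hB
  set u : ℝ := B ^ (-σ) / 12 with hu
  have hu0 : 0 < u := by positivity
  -- On `[X, BX]`, `l/(2σ) ≤ log N ≤ 3l/σ` with `l = log‖y‖`. As `X^{-σ} = (K‖y‖l)⁻¹`, the value
  -- `6/σ` gives the upper bound `1/2` and the lower bound `u = B^{-σ}/12`.
  set K : ℝ := 6 / σ with hK
  have hK0 : 0 < K := by positivity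
  refine ⟨u ^ 2 / 100 * (σ / 3 * K ^ (1 / σ)), by positivity, fun s hs => ?_⟩
  have hs2 : 1 / 2 < s.re := by rw [hs]; exact hσ
  -- The second and third thresholds give `log(BX) ≤ 3l/σ` and `log X ≥ l/(2σ)`; the last makes
  -- `N^{-σ} ≤ 1/20`, so the relative error `4N^{-σ}` is below `3/10`.
  filter_upwards [eventually_le_log_norm 1, eventually_le_log_norm (σ * Real.log B + Real.log K),
    eventually_le_log_norm (-2 * Real.log K),
    tendsto_norm_cobounded_atTop.eventually_ge_atTop (20 / K)] with y hl hl1 hl2 hy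
  have hy0 : 0 < ‖y‖ := lt_of_lt_of_le (by positivity) hy
  set l : ℝ := Real.log ‖y‖ with hldef
  have hl0 : 0 < l := by linarith
  have hKy : 20 ≤ K * ‖y‖ * l := by
    rw [div_le_iff₀ hK0] at hy
    nlinarith
  set X : ℝ := (K * ‖y‖ * l) ^ (1 / σ) with hXdef
  have hX1 : 1 < X := Real.one_lt_rpow (by linarith) (by positivity)
  have hX0 : 0 < X := by linarith
  have hXσ : X ^ (-σ) = (K * ‖y‖ * l)⁻¹ := by
    rw [hXdef, ← Real.rpow_mul (by positivity), show 1 / σ * -σ = -1 by field_simp,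
      Real.rpow_neg_one]
  have hlogX : σ * Real.log X = Real.log K + l + Real.log l := by
    rw [hXdef, Real.log_rpow (by positivity), Real.log_mul (by positivity) hl0.ne',
      Real.log_mul hK0.ne' hy0.ne', ← hldef]
    field_simp
  have hll : Real.log l ≤ l := (Real.log_le_sub_one_of_pos hl0).trans (by linarith)
  have hll0 : 0 ≤ Real.log l := Real.log_nonneg hl
  have hlogBX : Real.log (B * X) ≤ 3 * l / σ := by
    rw [le_div_iff₀ hσ0, Real.log_mul hB0.ne' hX0.ne']
    linarith
  have hlogXlow : l / (2 * σ) ≤ Real.log X := by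
    rw [div_le_iff₀ (by positivity)]
    linarith
  refine (hmain (aLogDeriv s) (fun N => (Real.log N : ℂ) * (N : ℂ) ^ (-s)) y X u
    (multipliable_eulerFactor_aLogDeriv hs2 y) hX1.le hu0.le fun N hXN hNB => ?_).trans
    (Real.exp_le_exp.2 ?_)
  · obtain ⟨hlow, hup⟩ := rpow_neg_bounds hσ0 hB0 hX0 hXN hNB
    rw [hXσ] at hlow hup
    have hN1 : (1 : ℝ) < N := hX1.trans_le hXN
    have hN2 : 2 ≤ N := by exact_mod_cast hN1
    have hc : ‖(Real.log N : ℂ) * (N : ℂ) ^ (-s)‖ = Real.log N * (N : ℝ) ^ (-σ) := by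
      rw [norm_log_mul_cpow (by omega), hs]
    have hlN : l / (2 * σ) ≤ Real.log N := hlogXlow.trans (Real.log_le_log hX0 hXN)
    have hlN' : Real.log N ≤ 3 * l / σ :=
      (Real.log_le_log (by linarith) hNB).trans hlogBX
    have hlN0 : 0 ≤ Real.log N := Real.log_natCast_nonneg N
    refine ⟨fun j _ => (norm_aLogDeriv_sub_le hs2 hN2 j).trans ?_, ?_, ?_⟩
    · have h20 : (N : ℝ) ^ (-s.re) ≤ 1 / 20 := by
        rw [hs]
        refine hup.trans ?_
        rw [inv_le_comm₀ (by positivity) (by norm_num)]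
        linarith
      nlinarith [norm_nonneg ((Real.log N : ℂ) * (N : ℂ) ^ (-s))]
    · rw [hc]
      calc u = ‖y‖ * (l / (2 * σ) * (B ^ (-σ) * (K * ‖y‖ * l)⁻¹)) := by
            rw [hu, hK]
            field_simp
            norm_num
        _ ≤ _ := by gcongr
    · rw [hc]
      calc ‖y‖ * (Real.log N * (N : ℝ) ^ (-σ)) ≤ ‖y‖ * (3 * l / σ * (K * ‖y‖ * l)⁻¹) := by gcongr
        _ = 1 / 2 := by
          rw [hK]
          field_simp
          norm_num
  · have hlog0 : 0 < Real.log (B * X) := Real.log_pos (by nlinarith)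
    have hfin : X / (3 * l / σ) ≤ X / Real.log (B * X) :=
      div_le_div_of_nonneg_left hX0.le hlog0 hlogBX
    calc -(u ^ 2 / 100 * (X / Real.log (B * X)))
        ≤ -(u ^ 2 / 100 * (X / (3 * l / σ))) := neg_le_neg (by gcongr)
      _ = _ := by
        rw [hXdef, Real.mul_rpow (by positivity) hl0.le, Real.mul_rpow hK0.le hy0.le,
          Real.rpow_sub_one hl0.ne']
        field_simp

end CubicTwists

theorem mainTheorem3 (σ : ℝ) (hσ : 1 / 2 < σ) :
    (∃ C₁ : ℝ, 0 < C₁ ∧ ∀ s : ℂ, s.re = σ →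
      (∀ y : ℂ, Multipliable (CubicTwists.eulerFactor (CubicTwists.aLog s) y)) ∧
      ∀ᶠ y : ℂ in Bornology.cobounded ℂ,
        ‖CubicTwists.MtildeLog s y‖ ≤
          Real.exp (-C₁ * ‖y‖ ^ (1 / σ) * (Real.log ‖y‖)⁻¹)) ∧
    (∃ C₂ : ℝ, 0 < C₂ ∧ ∀ s : ℂ, s.re = σ →
      (∀ y : ℂ, Multipliable (CubicTwists.eulerFactor (CubicTwists.aLogDeriv s) y)) ∧
      ∀ᶠ y : ℂ in Bornology.cobounded ℂ,
        ‖CubicTwists.MtildeLogDeriv s y‖ ≤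
          Real.exp (-C₂ * ‖y‖ ^ (1 / σ) * Real.log ‖y‖ ^ (1 / σ - 1))) := by
  obtain ⟨C₁, hC₁, h₁⟩ := CubicTwists.exists_norm_MtildeLog_le hσ
  obtain ⟨C₂, hC₂, h₂⟩ := CubicTwists.exists_norm_MtildeLogDeriv_le hσ
  exact ⟨⟨C₁, hC₁, fun s hs =>
      ⟨CubicTwists.multipliable_eulerFactor_aLog (by rw [hs]; exact hσ), h₁ s hs⟩⟩,
    ⟨C₂, hC₂, fun s hs =>
      ⟨CubicTwists.multipliable_eulerFactor_aLogDeriv (by rw [hs]; exact hσ), h₂ s hs⟩⟩⟩
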